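/- For complex numbers $a,q$ and an integer $n\ge 0$ let $(a;q)_n=\prod_{k=0}^{n-1}(1-aq^k)$, and for $|q|<1$ let $(a;q)_\infty=\prod_{k=0}^{\infty}(1-aq^k)$ and $(a_1,\dots,a_m;q)_\infty=(a_1;q)_\infty\cdots(a_m;q)_\infty$. Then for all $q\in\mathbb{C}$ with $|q|<1$ and all $z\in\mathbb{C}\setminus\{0\}$, the following series converges (absolutely) and $$\sum_{n=0}^{\infty}\frac{(q/z;q)_{n+1}\,(z;q)_n\,q^{n^2+n}}{(q;q)_{2n+1}}=\frac{(q^2z,\;q/z,\;q^3;\;q^3)_\infty}{(q;q)_\infty}.$$ -/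

import Mathlib

/-- The finite `q`-shifted factorial `(a;q)_n = (1-a)(1-aq)⋯(1-aq^{n-1})`. -/
noncomputable def qPoch (a q : ℂ) (n : ℕ) : ℂ :=
  ∏ k ∈ Finset.range n, (1 - a * q ^ k)

/-- The infinite `q`-shifted factorial `(a;q)_∞ = (1-a)(1-aq)(1-aq^2)⋯`. -/
noncomputable def qPochInf (a q : ℂ) : ℂ :=
  ∏' k : ℕ, (1 - a * q ^ k)

/-- The infinite product defining `(a;q)_∞` converges for `|q| < 1`, so that `qPochInf a q`
is its genuine value. -/
theorem multipliable_qPochInf (a q : ℂ) (hq : ‖q‖ < 1) :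
    Multipliable (fun k : ℕ => 1 - a * q ^ k) := by
  have h : Summable (fun k : ℕ => ‖-(a * q ^ k)‖) := by
    simpa [norm_mul, norm_pow] using
      (summable_geometric_of_lt_one (norm_nonneg q) hq).mul_left ‖a‖
  simpa [sub_eq_add_neg] using multipliable_one_add_of_summable h

/-!
Expand the factor `(q/z;q)_{n+1} (z;q)_n / (q;q)_{2n+1}` of the summand by the finite form of the
Jacobi triple product identity, as a sum over `k : ℤ` of theta terms `(-q/z)^k q^{k(k-1)/2}` over
`(q;q)_{n+k} (q;q)_{n+1-k}`, and interchange the two summations. By Cauchy's identity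
`∑_j q^{j(j+m)} / ((q;q)_j (q;q)_{j+m}) = 1 / (q;q)_∞` the inner sum over `n` is
`q^{k(k-1)} / (q;q)_∞`. The extra factor `q^{k(k-1)}` turns the theta series of base `q` into that
of base `q^3`, which the triple product identity evaluates.

Both the triple product identity and Cauchy's identity are limits of finite identities, each
proved by induction from the recurrence of `1 / (q;q)_i`.
-/

open Filter Topology

section

variable {q x : ℂ}

theorem qPoch_succ (a q : ℂ) (n : ℕ) : qPoch a q (n + 1) = qPoch a q n * (1 - a * q ^ n) :=
  Finset.prod_range_succ _ _

theorem tendsto_qPoch (a : ℂ) (hq : ‖q‖ < 1) :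
    Tendsto (qPoch a q) atTop (𝓝 (qPochInf a q)) :=
  (multipliable_qPochInf a q hq).tendsto_prod_tprod_nat

theorem not_isOfFinOrder_of_norm_lt_one (hq : ‖q‖ < 1) : ¬ IsOfFinOrder q :=
  fun h => hq.ne h.norm_eq_one

theorem one_sub_pow_succ_ne_zero (hq : ¬ IsOfFinOrder q) (n : ℕ) : 1 - q ^ (n + 1) ≠ 0 :=
  fun h => hq (isOfFinOrder_iff_pow_eq_one.2 ⟨n + 1, n.succ_pos, (sub_eq_zero.1 h).symm⟩)

theorem qPochInf_self_ne_zero (hq : ‖q‖ < 1) : qPochInf q q ≠ 0 := by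
  have hsum : Summable fun k : ℕ => ‖-(q * q ^ k)‖ := by
    simpa only [norm_neg, norm_mul, norm_pow] using
      (summable_geometric_of_lt_one (norm_nonneg q) hq).mul_left ‖q‖
  have hne := tprod_one_add_ne_zero_of_summable (fun k => by
    rw [← sub_eq_add_neg, ← pow_succ']
    exact one_sub_pow_succ_ne_zero (not_isOfFinOrder_of_norm_lt_one hq) k) hsum
  simpa only [qPochInf, ← sub_eq_add_neg] using hne

/-- The reciprocal `1 / (q;q)_i`, extended by `0` to `i < 0`. With this convention its recurrence
holds for all integers `i`, and the finite sums below may be taken over all of `ℤ`. -/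
noncomputable def invQPoch (q : ℂ) (i : ℤ) : ℂ :=
  if i < 0 then 0 else (qPoch q q i.toNat)⁻¹

theorem invQPoch_natCast (q : ℂ) (n : ℕ) : invQPoch q n = (qPoch q q n)⁻¹ := by
  simp [invQPoch]

theorem invQPoch_zero (q : ℂ) : invQPoch q 0 = 1 := by
  simp [invQPoch, qPoch]

theorem invQPoch_of_neg (q : ℂ) {i : ℤ} (hi : i < 0) : invQPoch q i = 0 := if_pos hi

theorem invQPoch_sub_one (hq : ¬ IsOfFinOrder q) (i : ℤ) :
    invQPoch q (i - 1) = (1 - q ^ i) * invQPoch q i := by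
  rcases lt_trichotomy i 0 with hi | rfl | hi
  · rw [invQPoch_of_neg q hi, invQPoch_of_neg q (by omega), mul_zero]
  · rw [invQPoch_of_neg q (by omega), zpow_zero, sub_self, zero_mul]
  · obtain ⟨n, rfl⟩ : ∃ n : ℕ, i = (n + 1 : ℕ) := ⟨(i - 1).toNat, by omega⟩
    rw [Nat.cast_succ, add_sub_cancel_right, ← Nat.cast_succ, invQPoch_natCast, invQPoch_natCast,
      zpow_natCast, qPoch_succ, ← pow_succ', mul_inv_rev,
      mul_inv_cancel_left₀ (one_sub_pow_succ_ne_zero hq n)]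

theorem invQPoch_succ (hq : ¬ IsOfFinOrder q) (n : ℕ) :
    invQPoch q (n + 1) = (1 - q ^ (n + 1))⁻¹ * invQPoch q n := by
  have h := invQPoch_sub_one hq (n + 1)
  rw [add_sub_cancel_right] at h
  rw [h, ← Nat.cast_succ, zpow_natCast, inv_mul_cancel_left₀ (one_sub_pow_succ_ne_zero hq n)]

theorem tendsto_inv_qPoch_self (hq : ‖q‖ < 1) :
    Tendsto (fun n => (qPoch q q n)⁻¹) atTop (𝓝 (qPochInf q q)⁻¹) :=
  (tendsto_qPoch q hq).inv₀ (qPochInf_self_ne_zero hq)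

theorem tendsto_invQPoch (hq : ‖q‖ < 1) :
    Tendsto (invQPoch q) atTop (𝓝 (qPochInf q q)⁻¹) := by
  have htop : Tendsto Int.toNat atTop atTop :=
    tendsto_atTop.2 fun n => (eventually_ge_atTop (n : ℤ)).mono fun i hi => by omega
  refine ((tendsto_inv_qPoch_self hq).comp htop).congr' ?_
  filter_upwards [eventually_ge_atTop 0] with i hi
  exact (if_neg hi.not_gt).symm

theorem tendsto_invQPoch_natCast_add (hq : ‖q‖ < 1) (i : ℤ) :
    Tendsto (fun n : ℕ => invQPoch q (n + i)) atTop (𝓝 (qPochInf q q)⁻¹) :=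
  (tendsto_invQPoch hq).comp (tendsto_atTop_add_const_right _ i tendsto_natCast_atTop_atTop)

theorem exists_norm_invQPoch_le (hq : ‖q‖ < 1) : ∃ B, 0 ≤ B ∧ ∀ i, ‖invQPoch q i‖ ≤ B := by
  obtain ⟨B, hB⟩ := (Metric.isBounded_range_of_tendsto _ (tendsto_inv_qPoch_self hq)).exists_norm_le
  have hB0 : 0 ≤ B := (norm_nonneg _).trans (hB _ ⟨0, rfl⟩)
  refine ⟨B, hB0, fun i => ?_⟩
  unfold invQPoch
  split_ifs
  · rwa [norm_zero]
  · exact hB _ ⟨_, rfl⟩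

/-- The general term `(-x)^k q^{k(k-1)/2}` of the bilateral theta series of base `q`. -/
noncomputable def thetaTerm (x q : ℂ) (k : ℤ) : ℂ :=
  (-x) ^ k * q ^ (k * (k - 1) / 2)

theorem thetaTerm_add_one (hx : x ≠ 0) (hq0 : q ≠ 0) (k : ℤ) :
    thetaTerm x q (k + 1) = -x * q ^ k * thetaTerm x q k := by
  have h : (k + 1) * (k + 1 - 1) / 2 = k * (k - 1) / 2 + k := by
    rw [show (k + 1) * (k + 1 - 1) = k * (k - 1) + k * 2 by ring,
      Int.add_mul_ediv_right _ _ two_ne_zero]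
  rw [thetaTerm, thetaTerm, h, zpow_add₀ hq0, zpow_add_one₀ (neg_ne_zero.2 hx)]
  ring

theorem thetaTerm_div_neg (hq0 : q ≠ 0) (x : ℂ) (k : ℤ) :
    thetaTerm (q / x) q (-k) = thetaTerm x q k := by
  have h : -k * (-k - 1) / 2 = k * (k - 1) / 2 + k := by
    rw [show -k * (-k - 1) = k * (k - 1) + k * 2 by ring,
      Int.add_mul_ediv_right _ _ two_ne_zero]
  rw [thetaTerm, thetaTerm, h, zpow_add₀ hq0, ← div_neg, zpow_neg, div_zpow, inv_div]
  field_simp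

theorem thetaTerm_sq (hq0 : q ≠ 0) (c k : ℤ) :
    thetaTerm (-q ^ (c + 1)) (q ^ 2) k = q ^ (k * (k + c)) := by
  have h : 2 * (k * (k - 1) / 2) = k * (k - 1) :=
    Int.mul_ediv_cancel' (Int.even_mul_pred_self k).two_dvd
  rw [thetaTerm, neg_neg, ← zpow_natCast q 2, ← zpow_mul, ← zpow_mul, ← zpow_add₀ hq0,
    Nat.cast_two, h]
  congr 1
  ring

theorem zpow_mul_thetaTerm (hq0 : q ≠ 0) (x : ℂ) (k : ℤ) :
    q ^ (k * (k - 1)) * thetaTerm x q k = thetaTerm x (q ^ 3) k := by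
  have h : 2 * (k * (k - 1) / 2) = k * (k - 1) :=
    Int.mul_ediv_cancel' (Int.even_mul_pred_self k).two_dvd
  rw [thetaTerm, thetaTerm, mul_left_comm, ← zpow_natCast q 3, ← zpow_mul, ← zpow_add₀ hq0]
  congr 2
  omega

theorem summable_thetaTerm_natCast (hx : x ≠ 0) (hq0 : q ≠ 0) (hq : ‖q‖ < 1) :
    Summable fun k : ℕ => thetaTerm x q k := by
  have hne (k : ℕ) : thetaTerm x q k ≠ 0 :=
    mul_ne_zero (zpow_ne_zero _ (neg_ne_zero.2 hx)) (zpow_ne_zero _ hq0)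
  have hratio (k : ℕ) : ‖x‖ * ‖q‖ ^ k = ‖thetaTerm x q (k + 1 : ℕ)‖ / ‖thetaTerm x q k‖ := by
    rw [Nat.cast_succ, thetaTerm_add_one hx hq0, ← norm_div, mul_div_cancel_right₀ _ (hne k),
      norm_mul, norm_neg, norm_zpow, zpow_natCast]
  have hlim : Tendsto (fun k : ℕ => ‖x‖ * ‖q‖ ^ k) atTop (𝓝 0) := by
    simpa only [mul_zero] using
      (tendsto_pow_atTop_nhds_zero_of_lt_one (norm_nonneg q) hq).const_mul ‖x‖
  exact summable_of_ratio_test_tendsto_lt_one zero_lt_one (.of_forall hne) (hlim.congr hratio)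

theorem summable_thetaTerm (hx : x ≠ 0) (hq0 : q ≠ 0) (hq : ‖q‖ < 1) :
    Summable (thetaTerm x q) := by
  refine .of_nat_of_neg (summable_thetaTerm_natCast hx hq0 hq) ?_
  have h := summable_thetaTerm_natCast (div_ne_zero hq0 hx) hq0 hq
  refine h.congr fun k => ?_
  rw [← thetaTerm_div_neg hq0 x (-k), neg_neg]

theorem summable_zpow_mul_add (hq0 : q ≠ 0) (hq : ‖q‖ < 1) (c : ℤ) :
    Summable fun n : ℤ => q ^ (n * (n + c)) := by
  have hq2 : ‖q ^ 2‖ < 1 := by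
    rw [norm_pow]
    exact pow_lt_one₀ (norm_nonneg q) hq two_ne_zero
  exact (summable_thetaTerm (neg_ne_zero.2 (zpow_ne_zero (c + 1) hq0)) (pow_ne_zero 2 hq0)
    hq2).congr fun n => thetaTerm_sq hq0 c n

/-- The kernel `1 / ((q;q)_{n+k} (q;q)_{m-k})`, supported on `-n ≤ k ≤ m`, which for `m = n + c`
relates the two sequences of a bilateral Bailey pair relative to `q^c`. -/
noncomputable def baileyKernel (q : ℂ) (m n k : ℤ) : ℂ :=
  invQPoch q (n + k) * invQPoch q (m - k)

theorem baileyKernel_eq_zero (q : ℂ) {m n k : ℤ} (hk : k ∉ Set.Icc (-n) m) :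
    baileyKernel q m n k = 0 := by
  rcases not_and_or.1 hk with hk | hk
  · rw [baileyKernel, invQPoch_of_neg q (i := n + k) (by omega), zero_mul]
  · rw [baileyKernel, invQPoch_of_neg q (i := m - k) (by omega), mul_zero]

theorem baileyKernel_neg (q : ℂ) (m n k : ℤ) :
    baileyKernel q n m (-k) = baileyKernel q m n k := by
  rw [baileyKernel, baileyKernel, sub_neg_eq_add, ← sub_eq_add_neg, mul_comm]

theorem exists_norm_baileyKernel_le (hq : ‖q‖ < 1) :
    ∃ B, ∀ m n k, ‖baileyKernel q m n k‖ ≤ B := by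
  obtain ⟨B, _, hB⟩ := exists_norm_invQPoch_le hq
  exact ⟨B * B, fun m n k => norm_mul_le_of_le (hB _) (hB _)⟩

theorem one_sub_mul_thetaTerm_mul_baileyKernel (hx : x ≠ 0) (hq0 : q ≠ 0)
    (hq : ¬ IsOfFinOrder q) (m n k : ℤ) :
    (1 - q ^ (m + n + 1)) * (thetaTerm x q k * baileyKernel q (m + 1) n k) =
      thetaTerm x q k * baileyKernel q m n k -
        x * q ^ m * (thetaTerm x q (k - 1) * baileyKernel q m n (k - 1)) := by
  have htheta : thetaTerm x q k = -x * q ^ (k - 1) * thetaTerm x q (k - 1) := by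
    rw [← thetaTerm_add_one hx hq0, sub_add_cancel]
  have hn : invQPoch q (n + (k - 1)) = (1 - q ^ (n + k)) * invQPoch q (n + k) := by
    rw [← invQPoch_sub_one hq, add_sub_assoc]
  have hm : invQPoch q (m - k) = (1 - q ^ (m + 1 - k)) * invQPoch q (m + 1 - k) := by
    rw [← invQPoch_sub_one hq, add_sub_right_comm, add_sub_cancel_right]
  have hpow : q ^ m = q ^ (m + 1 - k) * q ^ (k - 1) := by
    rw [← zpow_add₀ hq0]
    ring_nf
  have hpow' : q ^ (m + n + 1) = q ^ (m + 1 - k) * q ^ (n + k) := by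
    rw [← zpow_add₀ hq0]
    ring_nf
  simp only [baileyKernel]
  rw [htheta, hn, hm, hpow, hpow', show m - (k - 1) = m + 1 - k by ring]
  ring

theorem hasSum_thetaTerm_mul_baileyKernel_succ (hx : x ≠ 0) (hq0 : q ≠ 0)
    (hq : ¬ IsOfFinOrder q) {m n : ℕ} {s : ℂ}
    (h : HasSum (fun k => thetaTerm x q k * baileyKernel q m n k) s) :
    HasSum (fun k => thetaTerm x q k * baileyKernel q (m + 1 : ℕ) n k)
      ((1 - q ^ (m + n + 1))⁻¹ * ((1 - x * q ^ m) * s)) := by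
  have hshift := ((Equiv.subRight (1 : ℤ)).hasSum_iff.2 h).mul_left (x * q ^ m)
  rw [one_sub_mul]
  refine ((h.sub hshift).mul_left _).congr_fun fun k => ?_
  rw [eq_inv_mul_iff_mul_eq₀ (one_sub_pow_succ_ne_zero hq (m + n))]
  exact_mod_cast one_sub_mul_thetaTerm_mul_baileyKernel hx hq0 hq m n k

theorem hasSum_thetaTerm_div_mul_baileyKernel_iff (hq0 : q ≠ 0) (x : ℂ) (m n : ℤ) {s : ℂ} :
    HasSum (fun k => thetaTerm (q / x) q k * baileyKernel q n m k) s ↔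
      HasSum (fun k => thetaTerm x q k * baileyKernel q m n k) s := by
  rw [← (Equiv.neg ℤ).hasSum_iff]
  simp only [Function.comp_def, Equiv.neg_apply, thetaTerm_div_neg hq0, baileyKernel_neg]

theorem hasSum_finite_jacobi_triple_product (hx : x ≠ 0) (hq0 : q ≠ 0) (hq : ¬ IsOfFinOrder q)
    (m n : ℕ) :
    HasSum (fun k => thetaTerm x q k * baileyKernel q m n k)
      (qPoch x q m * qPoch (q / x) q n * invQPoch q (m + n : ℕ)) := by
  induction m with
  | zero =>
    induction n with
    | zero =>
      have hzero (k : ℤ) (hk : k ≠ 0) :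
          thetaTerm x q k * baileyKernel q (0 : ℕ) (0 : ℕ) k = 0 := by
        rw [baileyKernel_eq_zero q (by simpa using hk), mul_zero]
      simpa [thetaTerm, baileyKernel, invQPoch_zero, qPoch] using hasSum_single 0 hzero
    | succ n ih =>
      have h := hasSum_thetaTerm_mul_baileyKernel_succ (div_ne_zero hq0 hx) hq0 hq
        ((hasSum_thetaTerm_div_mul_baileyKernel_iff hq0 x (0 : ℕ) n).2 ih)
      convert (hasSum_thetaTerm_div_mul_baileyKernel_iff hq0 x (0 : ℕ) (n + 1 : ℕ)).1 h using 1
      rw [qPoch_succ, zero_add, zero_add, Nat.cast_succ, invQPoch_succ hq, add_zero]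
      ring
  | succ m ih =>
    convert hasSum_thetaTerm_mul_baileyKernel_succ hx hq0 hq ih using 1
    rw [qPoch_succ, add_right_comm, Nat.cast_succ, invQPoch_succ hq]
    ring

theorem tsum_thetaTerm_mul_inv_mul_inv (hx : x ≠ 0) (hq0 : q ≠ 0) (hq : ‖q‖ < 1) :
    ∑' k, thetaTerm x q k * ((qPochInf q q)⁻¹ * (qPochInf q q)⁻¹) =
      qPochInf x q * qPochInf (q / x) q * (qPochInf q q)⁻¹ := by
  obtain ⟨B, hB⟩ := exists_norm_baileyKernel_le hq
  have hseries : Tendsto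
      (fun n : ℕ => ∑' k, thetaTerm x q k * baileyKernel q n n k) atTop
      (𝓝 (∑' k, thetaTerm x q k * ((qPochInf q q)⁻¹ * (qPochInf q q)⁻¹))) := by
    refine tendsto_tsum_of_dominated_convergence (bound := fun k => ‖thetaTerm x q k‖ * B)
      ((summable_thetaTerm hx hq0 hq).norm.mul_right _) (fun k => ?_) (.of_forall fun n k => ?_)
    · exact tendsto_const_nhds.mul ((tendsto_invQPoch_natCast_add hq k).mul
        (tendsto_invQPoch_natCast_add hq (-k)))
    · rw [norm_mul]
      gcongr
      exact hB _ _ _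
  have hproduct : Tendsto
      (fun n : ℕ => qPoch x q n * qPoch (q / x) q n * invQPoch q (n + n : ℕ)) atTop
      (𝓝 (qPochInf x q * qPochInf (q / x) q * (qPochInf q q)⁻¹)) :=
    ((tendsto_qPoch x hq).mul (tendsto_qPoch (q / x) hq)).mul ((tendsto_invQPoch hq).comp
      (tendsto_natCast_atTop_atTop.comp (tendsto_id.atTop_add_atTop tendsto_id)))
  have hfinite := hasSum_finite_jacobi_triple_product hx hq0 (not_isOfFinOrder_of_norm_lt_one hq)
  exact tendsto_nhds_unique (hseries.congr fun n => (hfinite n n).tsum_eq) hproduct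

theorem hasSum_jacobi_triple_product (hx : x ≠ 0) (hq0 : q ≠ 0) (hq : ‖q‖ < 1) :
    HasSum (thetaTerm x q) (qPochInf x q * qPochInf (q / x) q * qPochInf q q) := by
  have hinf := qPochInf_self_ne_zero hq
  have h := tsum_thetaTerm_mul_inv_mul_inv hx hq0 hq
  rw [tsum_mul_right] at h
  convert (summable_thetaTerm hx hq0 hq).hasSum using 1
  field_simp at h
  rw [h]
  ring

/-- The general term `q^{j(j+m)} / ((q;q)_j (q;q)_{i-j} (q;q)_{j+m})` of the finite form of
Cauchy's identity; up to the constant `(q;q)_i`, the first two denominators form a `q`-binomial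
coefficient. -/
noncomputable def cauchyTerm (q : ℂ) (i m j : ℤ) : ℂ :=
  q ^ (j * (j + m)) * (invQPoch q j * invQPoch q (i - j) * invQPoch q (j + m))

theorem cauchyTerm_eq_zero (q : ℂ) {i j : ℤ} (m : ℤ) (hj : j ∉ Finset.Icc 0 i) :
    cauchyTerm q i m j = 0 := by
  rw [Finset.mem_Icc, not_and_or] at hj
  rcases hj with hj | hj
  · rw [cauchyTerm, invQPoch_of_neg q (by omega), zero_mul, zero_mul, mul_zero]
  · rw [cauchyTerm, invQPoch_of_neg q (i := i - j) (by omega), mul_zero, zero_mul, mul_zero]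

theorem one_sub_mul_cauchyTerm_add_one (hq0 : q ≠ 0) (hq : ¬ IsOfFinOrder q) (i m j : ℤ) :
    (1 - q ^ (i + 1)) * cauchyTerm q (i + 1) m j =
      cauchyTerm q i (m + 1) j -
        (q ^ (j + m + 1) * cauchyTerm q i (m + 1) j -
          q ^ (j - 1 + m + 1) * cauchyTerm q i (m + 1) (j - 1)) := by
  have hj := invQPoch_sub_one hq j
  have hi : invQPoch q (i - j) = (1 - q ^ (i + 1 - j)) * invQPoch q (i + 1 - j) := by
    rw [← invQPoch_sub_one hq, add_sub_right_comm, add_sub_cancel_right]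
  have hm : invQPoch q (j + m) = (1 - q ^ (j + m + 1)) * invQPoch q (j + m + 1) := by
    rw [← invQPoch_sub_one hq, add_sub_cancel_right]
  have hpow : q ^ (i + 1) = q ^ (i + 1 - j) * q ^ j := by
    rw [← zpow_add₀ hq0, sub_add_cancel]
  have hpow_same : q ^ (j * (j + m + 1)) = q ^ (j * (j + m)) * q ^ j := by
    rw [← zpow_add₀ hq0]
    ring_nf
  have hpow_prev : q ^ (j + m) * q ^ ((j - 1) * (j + m)) = q ^ (j * (j + m)) := by
    rw [← zpow_add₀ hq0]
    ring_nf
  simp only [cauchyTerm]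
  rw [show j - 1 + m + 1 = j + m by ring, show j - 1 + (m + 1) = j + m by ring,
    show i - (j - 1) = i + 1 - j by ring, ← add_assoc j m 1, ← mul_assoc (q ^ (j + m)), hpow_prev,
    hj, hi, hm, hpow, hpow_same]
  ring

theorem hasSum_finite_cauchy (hq0 : q ≠ 0) (hq : ¬ IsOfFinOrder q) (N : ℕ) (m : ℤ) :
    HasSum (cauchyTerm q N m) (invQPoch q N * invQPoch q (N + m)) := by
  induction N generalizing m with
  | zero =>
    have hzero (j : ℤ) (hj : j ≠ 0) : cauchyTerm q (0 : ℕ) m j = 0 :=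
      cauchyTerm_eq_zero q m (by simpa using hj)
    simpa [cauchyTerm, invQPoch_zero] using hasSum_single 0 hzero
  | succ N ih =>
    set u : ℤ → ℂ := fun j => q ^ (j + m + 1) * cauchyTerm q N (m + 1) j
    have hu : Summable u :=
      summable_of_ne_finset_zero (s := Finset.Icc 0 (N : ℤ)) fun j hj => by
        simp only [u, cauchyTerm_eq_zero q (m + 1) hj, mul_zero]
    have htelescope : HasSum (fun j => u j - u (j - 1)) 0 := by
      rw [← sub_self (∑' j, u j)]
      exact hu.hasSum.sub ((Equiv.subRight (1 : ℤ)).hasSum_iff.2 hu.hasSum)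
    have hvalue : invQPoch q (N + 1 : ℕ) * invQPoch q ((N + 1 : ℕ) + m) =
        (1 - q ^ (N + 1))⁻¹ * (invQPoch q N * invQPoch q (N + (m + 1)) - 0) := by
      rw [Nat.cast_succ, invQPoch_succ hq, sub_zero, mul_assoc, add_assoc, add_comm 1 m]
    rw [hvalue]
    refine (((ih (m + 1)).sub htelescope).mul_left _).congr_fun fun j => ?_
    rw [eq_inv_mul_iff_mul_eq₀ (one_sub_pow_succ_ne_zero hq N)]
    exact_mod_cast one_sub_mul_cauchyTerm_add_one hq0 hq N m j

theorem summable_zpow_mul_invQPoch (hq0 : q ≠ 0) (hq : ‖q‖ < 1) (m : ℤ) :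
    Summable fun j : ℤ => q ^ (j * (j + m)) * (invQPoch q j * invQPoch q (j + m)) := by
  obtain ⟨B, hB0, hB⟩ := exists_norm_invQPoch_le hq
  refine .of_norm_bounded ((summable_zpow_mul_add hq0 hq m).norm.mul_right (B * B)) fun j => ?_
  rw [norm_mul, norm_mul]
  gcongr <;> exact hB _

theorem hasSum_cauchy (hq0 : q ≠ 0) (hq : ‖q‖ < 1) (m : ℤ) :
    HasSum (fun j : ℤ => q ^ (j * (j + m)) * (invQPoch q j * invQPoch q (j + m)))
      (qPochInf q q)⁻¹ := by
  obtain ⟨B, hB0, hB⟩ := exists_norm_invQPoch_le hq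
  have hinf := inv_ne_zero (qPochInf_self_ne_zero hq)
  have hseries : Tendsto
      (fun N : ℕ => ∑' j, cauchyTerm q N m j) atTop
      (𝓝 (∑' j : ℤ,
        q ^ (j * (j + m)) * (invQPoch q j * (qPochInf q q)⁻¹ * invQPoch q (j + m)))) := by
    refine tendsto_tsum_of_dominated_convergence
      (bound := fun j : ℤ => ‖q ^ (j * (j + m))‖ * (B * B * B))
      ((summable_zpow_mul_add hq0 hq m).norm.mul_right _) (fun j => ?_) (.of_forall fun N j => ?_)
    · exact ((tendsto_invQPoch_natCast_add hq (-j)).const_mul _).mul_const _ |>.const_mul _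
    · rw [cauchyTerm, norm_mul, norm_mul, norm_mul]
      gcongr <;> exact hB _
  have hproduct := (tendsto_invQPoch_natCast_add hq 0).mul (tendsto_invQPoch_natCast_add hq m)
  have hsum := tendsto_nhds_unique (hseries.congr fun N => (hasSum_finite_cauchy hq0
    (not_isOfFinOrder_of_norm_lt_one hq) N m).tsum_eq) (by simpa only [add_zero] using hproduct)
  simp only [mul_right_comm _ (qPochInf q q)⁻¹, ← mul_assoc _ _ (qPochInf q q)⁻¹] at hsum
  rw [tsum_mul_right] at hsum
  rw [← mul_right_cancel₀ hinf hsum]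
  exact (summable_zpow_mul_invQPoch hq0 hq m).hasSum

theorem hasSum_zpow_mul_baileyKernel (hq0 : q ≠ 0) (hq : ‖q‖ < 1) (c k : ℤ) :
    HasSum (fun n => q ^ (n * (n + c)) * baileyKernel q (n + c) n k)
      (q ^ (k * (k - c)) * (qPochInf q q)⁻¹) := by
  rw [← (Equiv.subRight k).hasSum_iff]
  refine ((hasSum_cauchy hq0 hq (c - 2 * k)).mul_left _).congr_fun fun j => ?_
  have hpow : q ^ ((j - k) * (j - k + c)) = q ^ (k * (k - c)) * q ^ (j * (j + (c - 2 * k))) := by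
    rw [← zpow_add₀ hq0]
    ring_nf
  rw [Function.comp_apply, Equiv.subRight_apply, baileyKernel, hpow, sub_add_cancel,
    show j - k + c - k = j + (c - 2 * k) by ring, mul_assoc]

/-- The limiting case of Bailey's lemma, for the bilateral Bailey pair relative to `q^c` whose
second sequence is `β n = ∑' k, α k * baileyKernel q (n + c) n k`. -/
theorem hasSum_bailey (hq0 : q ≠ 0) (hq : ‖q‖ < 1) (c : ℤ) {α : ℤ → ℂ} {s : ℂ}
    (hα : Summable α) (hs : HasSum (fun k => q ^ (k * (k - c)) * α k) s) :
    HasSum (fun n => q ^ (n * (n + c)) * ∑' k, α k * baileyKernel q (n + c) n k)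
      (s / qPochInf q q) := by
  obtain ⟨B, hB⟩ := exists_norm_baileyKernel_le hq
  set F : ℤ × ℤ → ℂ := fun p =>
    q ^ (p.1 * (p.1 + c)) * (α p.2 * baileyKernel q (p.1 + c) p.1 p.2)
  have hF : Summable F := by
    refine .of_norm_bounded (((summable_zpow_mul_add hq0 hq c).norm.mul_of_nonneg hα.norm
      (fun _ => norm_nonneg _) (fun _ => norm_nonneg _)).mul_right B) fun p => ?_
    rw [norm_mul, norm_mul, ← mul_assoc]
    gcongr
    exact hB _ _ _
  have hrow (n : ℤ) : HasSum (fun k => F (n, k))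
      (q ^ (n * (n + c)) * ∑' k, α k * baileyKernel q (n + c) n k) := by
    rw [← tsum_mul_left]
    exact (hF.prod_factor n).hasSum
  have hcol (k : ℤ) : HasSum (fun n => F (n, k)) (q ^ (k * (k - c)) * α k / qPochInf q q) := by
    rw [mul_comm _ (α k), mul_div_assoc, div_eq_mul_inv]
    exact ((hasSum_zpow_mul_baileyKernel hq0 hq c k).mul_left (α k)).congr_fun
      fun n => mul_left_comm _ _ _
  have htotal : ∑' p, F p = s / qPochInf q q :=
    (((Equiv.prodComm ℤ ℤ).hasSum_iff.2 hF.hasSum).prod_fiberwise hcol).unique (hs.div_const _)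
  rw [← htotal]
  exact hF.hasSum.prod_fiberwise hrow

theorem tsum_mul_baileyKernel_eq_zero (α : ℤ → ℂ) (q : ℂ) {m n : ℤ} (h : m + n < 0) :
    ∑' k, α k * baileyKernel q m n k = 0 := by
  refine (tsum_congr fun k => ?_).trans tsum_zero
  rw [baileyKernel_eq_zero q fun hk => by linarith [hk.1, hk.2], mul_zero]

theorem hasSum_qPoch_mul_qPoch_div (hx : x ≠ 0) (hq0 : q ≠ 0) (hq : ‖q‖ < 1) :
    HasSum
      (fun n : ℕ =>
        qPoch x q (n + 1) * qPoch (q / x) q n * q ^ (n ^ 2 + n) / qPoch q q (2 * n + 1))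
      (qPochInf x (q ^ 3) * qPochInf (q ^ 3 / x) (q ^ 3) * qPochInf (q ^ 3) (q ^ 3) /
        qPochInf q q) := by
  have hq3 : ‖q ^ 3‖ < 1 := by
    rw [norm_pow]
    exact pow_lt_one₀ (norm_nonneg q) hq three_ne_zero
  have htheta := hasSum_jacobi_triple_product hx (pow_ne_zero 3 hq0) hq3
  have hbailey := hasSum_bailey hq0 hq 1 (summable_thetaTerm hx hq0 hq)
    (htheta.congr_fun (zpow_mul_thetaTerm hq0 x))
  rw [← Nat.cast_injective.hasSum_iff fun n hn => ?_] at hbailey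
  · refine hbailey.congr_fun fun n => ?_
    have hrow := hasSum_finite_jacobi_triple_product hx hq0 (not_isOfFinOrder_of_norm_lt_one hq)
      (n + 1) n
    rw [show n + 1 + n = 2 * n + 1 by ring, invQPoch_natCast, Nat.cast_succ] at hrow
    rw [Function.comp_apply, hrow.tsum_eq,
      show (n : ℤ) * (n + 1) = (n ^ 2 + n : ℕ) by push_cast; ring, zpow_natCast]
    ring
  · have hneg : n < 0 := lt_of_not_ge fun h => hn ⟨n.toNat, Int.toNat_of_nonneg h⟩
    rw [tsum_mul_baileyKernel_eq_zero _ q (by omega), mul_zero]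

end

theorem theorem3p3 (q z : ℂ) (hq : ‖q‖ < 1) (hz : z ≠ 0) :
    HasSum
      (fun n : ℕ =>
        qPoch (q / z) q (n + 1) * qPoch z q n * q ^ (n ^ 2 + n) / qPoch q q (2 * n + 1))
      (qPochInf (q ^ 2 * z) (q ^ 3) * qPochInf (q / z) (q ^ 3) * qPochInf (q ^ 3) (q ^ 3) /
        qPochInf q q) := by
  rcases eq_or_ne q 0 with rfl | hq0
  · have h := hasSum_single (f := fun n : ℕ => qPoch (0 / z) 0 (n + 1) * qPoch z 0 n *
      (0 : ℂ) ^ (n ^ 2 + n) / qPoch 0 0 (2 * n + 1)) 0 (fun n hn => by simp [hn])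
    simpa [qPoch, qPochInf] using h
  · have h := hasSum_qPoch_mul_qPoch_div (div_ne_zero hq0 hz) hq0 hq
    have h_div : q / (q / z) = z := div_div_cancel₀ hq0
    have h_cube_div : q ^ 3 / (q / z) = q ^ 2 * z := by field_simp
    rwa [h_div, h_cube_div, mul_comm (qPochInf (q / z) _)] at h
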